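/- Throughout, a smooth Banach manifold modeled on a real Banach space $E$ is a topological space with a $C^\infty$ atlas of charts onto open subsets of $E$. Let $\mathrm{GL}_K(E)$ be the group of invertible bounded operators on $E$ of the form $I+K$ with $K$ compact. A smooth Banach manifold modeled on $E$ is called a Fredholm manifold if it has a Fredholm atlas, that is, an atlas consisting of charts of the given smooth structure such that for all charts $\phi_1,\phi_2$ of the atlas $D(\phi_2\circ\phi_1^{-1})(x)\in \mathrm{GL}_K(E)$ for all $x\in\phi_1(U_1\cap U_2)$, where $U_i$ is the domain of $\phi_i$. Let $M$ be a smooth Banach manifold modeled on $E$. (1) Suppose that $M$ is a Fredholm manifold, with Fredholm atlas $\mathcal A$. Let $E_0\subseteq E$ be a closed complemented subspace, and let $M_0\subseteq M$ be an embedded submanifold modeled on $E_0$: every point of $M_0$ lies in the domain $U$ of a slice chart, i.e. a chart $\phi:U\to E$ of the smooth manifold $M$ with $\phi(U\cap M_0)=\phi(U)\cap E_0$. Suppose that $M_0$ is a Fredholm submanifold: around every point of $M_0$ there is a slice chart $\phi$ that belongs to the Fredholm structure of $M$, i.e. for which $\mathcal A\cup\{\phi\}$ is again a Fredholm atlas.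 Then the total space of the normal bundle $\nu(M,M_0)=TM|_{M_0}/TM_0$, with its standard smooth structure, which is modeled on $E_0\times (E/E_0)$, is a Fredholm manifold. (2) If $M$ is a Fredholm manifold, then the total space of the tangent bundle $TM$, modeled on $E\times E$, is a Fredholm manifold. -/

import Mathlib

open Set Topology Manifold Bundle
open scoped ContDiff

noncomputable section

/-! ### Fredholm manifolds -/

/-- The Fredholm structure group `GL_K(V)`: the invertible bounded operators on `V` of the form
`I + K` with `K` compact, as a subset of the bounded operators. -/
def GLK (V : Type*) [NormedAddCommGroup V] [NormedSpace ℝ V] : Set (V →L[ℝ] V) :=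
  {T | IsUnit T ∧ IsCompactOperator (T - 1 : V →L[ℝ] V)}

/-- `A` is a Fredholm atlas on the smooth manifold `X`: its members are charts of `X` with values in
the model vector space `V`, compatible with the given smooth structure (each of them is a
diffeomorphism from an open subset of `X` onto an open subset of `V`), they cover `X`, and the
differentials of all their transition maps lie in `GL_K(V)`. -/
structure IsFredholmAtlas {V : Type*} [NormedAddCommGroup V] [NormedSpace ℝ V]
    {H : Type*} [TopologicalSpace H] (I : ModelWithCorners ℝ V H)
    {X : Type*} [TopologicalSpace X] [ChartedSpace H X]
    (A : Set (OpenPartialHomeomorph X V)) : Prop where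
  covers : ∀ x : X, ∃ φ ∈ A, x ∈ φ.source
  smooth : ∀ φ ∈ A, ContMDiffOn I 𝓘(ℝ, V) ∞ φ φ.source
  smooth_symm : ∀ φ ∈ A, ContMDiffOn 𝓘(ℝ, V) I ∞ φ.symm φ.target
  transition : ∀ φ₁ ∈ A, ∀ φ₂ ∈ A, ∀ x ∈ φ₁ '' (φ₁.source ∩ φ₂.source),
    fderiv ℝ (φ₂ ∘ φ₁.symm) x ∈ GLK V

/-- `X` is a Fredholm manifold: it is a smooth manifold that has a Fredholm atlas. -/
def IsFredholmManifold {V : Type*} [NormedAddCommGroup V] [NormedSpace ℝ V]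
    {H : Type*} [TopologicalSpace H] (I : ModelWithCorners ℝ V H)
    (X : Type*) [TopologicalSpace X] [ChartedSpace H X] : Prop :=
  IsManifold I ∞ X ∧ ∃ A : Set (OpenPartialHomeomorph X V), IsFredholmAtlas I A

/-! ### Submanifolds of Banach manifolds -/

variable {E : Type*} [NormedAddCommGroup E] [NormedSpace ℝ E]
  {M : Type*} [TopologicalSpace M] [ChartedSpace E M]

/-- `φ` is a slice chart for the subset `S` of `M`, with respect to the subspace `E₀` of the model
space `E`: a chart of the smooth manifold `M` which maps `S ∩ U` onto `φ(U) ∩ E₀`, where `U` is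
the domain of `φ`. -/
structure IsSliceChart (E₀ : Submodule ℝ E) (S : Set M) (φ : OpenPartialHomeomorph M E) : Prop where
  mem_maximalAtlas : φ ∈ IsManifold.maximalAtlas 𝓘(ℝ, E) ∞ M
  mem_iff : ∀ x ∈ φ.source, x ∈ S ↔ φ x ∈ E₀

variable (M) in
/-- An embedded submanifold of `M` modeled on the closed complemented subspace `E₀` of `E`: a subset
every point of which lies in the domain of a slice chart. -/
structure EmbeddedSubmanifold (E₀ : Submodule ℝ E) where
  carrier : Set M
  closedComplemented : E₀.ClosedComplemented
  exists_sliceChart : ∀ p ∈ carrier, ∃ φ, IsSliceChart E₀ carrier φ ∧ p ∈ φ.source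

/-- The submanifold `S` is a Fredholm submanifold with respect to the Fredholm structure given by
the Fredholm atlas `A`: around every point of `S` there is a slice chart for `S` that belongs to the
Fredholm structure, i.e. that can be added to the Fredholm atlas `A`. -/
def IsFredholmSubmanifold {E₀ : Submodule ℝ E} (A : Set (OpenPartialHomeomorph M E))
    (S : EmbeddedSubmanifold M E₀) : Prop :=
  ∀ p ∈ S.carrier, ∃ φ, IsSliceChart E₀ S.carrier φ ∧ p ∈ φ.source ∧
    IsFredholmAtlas 𝓘(ℝ, E) (insert φ A)

namespace EmbeddedSubmanifold

variable {E₀ : Submodule ℝ E} (S : EmbeddedSubmanifold M E₀)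

instance : CoeSort (EmbeddedSubmanifold M E₀) (Type _) := ⟨fun S => S.carrier⟩

/-- A continuous linear projection of `E` onto `E₀`. -/
def proj : E →L[ℝ] E₀ := S.closedComplemented.choose

theorem proj_apply (x : E₀) : S.proj x = x := S.closedComplemented.choose_spec x

theorem coe_proj {x : E} (hx : x ∈ E₀) : (S.proj x : E) = x :=
  congrArg Subtype.val (S.proj_apply ⟨x, hx⟩)

variable {S}

open Classical in
/-- The chart `φ|S : S ∩ U → φ(U) ∩ E₀` of the submanifold `S` given by a slice chart `φ : U → E`.
(The point `p` is used only as a value of the inverse outside of the target of the chart.) -/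
def restrChart {φ : OpenPartialHomeomorph M E} (hφ : IsSliceChart E₀ S.carrier φ) (p : S) :
    OpenPartialHomeomorph S E₀ where
  toFun x := S.proj (φ x)
  invFun y := if h : φ.symm y ∈ S.carrier then ⟨φ.symm y, h⟩ else p
  source := Subtype.val ⁻¹' φ.source
  target := Subtype.val ⁻¹' φ.target
  map_source' x hx := by
    change (S.proj (φ x) : E) ∈ φ.target
    rw [S.coe_proj ((hφ.mem_iff _ hx).1 x.2)]
    exact φ.map_source hx
  map_target' y hy := by
    have h : φ.symm y ∈ S.carrier :=
      (hφ.mem_iff _ (φ.map_target hy)).2 (by rw [φ.right_inv hy]; exact y.2)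
    simpa [h] using φ.map_target hy
  left_inv' x hx := by
    have h1 : (S.proj (φ x) : E) = φ x := S.coe_proj ((hφ.mem_iff _ hx).1 x.2)
    have h2 : φ.symm (S.proj (φ x) : E) = x := by rw [h1]; exact φ.left_inv hx
    ext
    simp [h2]
  right_inv' y hy := by
    have h : φ.symm y ∈ S.carrier :=
      (hφ.mem_iff _ (φ.map_target hy)).2 (by rw [φ.right_inv hy]; exact y.2)
    simp only [h, dite_true]
    rw [φ.right_inv hy, S.proj_apply]
  open_source := φ.open_source.preimage continuous_subtype_val
  open_target := φ.open_target.preimage continuous_subtype_val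
  continuousOn_toFun := S.proj.continuous.comp_continuousOn
    (φ.continuousOn.comp continuous_subtype_val.continuousOn fun _ hx => hx)
  continuousOn_invFun := by
    rw [Topology.IsInducing.subtypeVal.continuousOn_iff]
    refine (φ.continuousOn_symm.comp continuous_subtype_val.continuousOn
      fun _ hx => hx).congr fun y hy => ?_
    have h : φ.symm y ∈ S.carrier :=
      (hφ.mem_iff _ (φ.map_target hy)).2 (by rw [φ.right_inv hy]; exact y.2)
    simp [h]

@[simp] theorem restrChart_apply {φ : OpenPartialHomeomorph M E}
    (hφ : IsSliceChart E₀ S.carrier φ) (p x : S) : restrChart hφ p x = S.proj (φ x) := rfl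

theorem coe_restrChart_apply {φ : OpenPartialHomeomorph M E}
    (hφ : IsSliceChart E₀ S.carrier φ) (p : S) {x : S} (hx : (x : M) ∈ φ.source) :
    (restrChart hφ p x : E) = φ x :=
  S.coe_proj ((hφ.mem_iff _ hx).1 x.2)

open Classical in
theorem coe_restrChart_symm_apply {φ : OpenPartialHomeomorph M E}
    (hφ : IsSliceChart E₀ S.carrier φ) (p : S) {y : E₀} (hy : (y : E) ∈ φ.target) :
    ((restrChart hφ p).symm y : M) = φ.symm y := by
  have h : φ.symm y ∈ S.carrier :=
    (hφ.mem_iff _ (φ.map_target hy)).2 (by rw [φ.right_inv hy]; exact y.2)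
  change ((if h : φ.symm y ∈ S.carrier then ⟨φ.symm y, h⟩ else p : S) : M) = _
  simp [h]

variable (S) in
/-- A slice chart around a point of `S`. -/
def sliceChartAt (p : S) : OpenPartialHomeomorph M E := (S.exists_sliceChart p p.2).choose

theorem isSliceChart_sliceChartAt (p : S) : IsSliceChart E₀ S.carrier (S.sliceChartAt p) :=
  (S.exists_sliceChart p p.2).choose_spec.1

theorem mem_sliceChartAt_source (p : S) : (p : M) ∈ (S.sliceChartAt p).source :=
  (S.exists_sliceChart p p.2).choose_spec.2

/-- A submanifold, with the subspace topology and with the restrictions of all its slice charts. -/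
instance : ChartedSpace E₀ S where
  atlas := {e | ∃ (φ : OpenPartialHomeomorph M E) (hφ : IsSliceChart E₀ S.carrier φ) (p : S),
    e = restrChart hφ p}
  chartAt p := restrChart (isSliceChart_sliceChartAt p) p
  mem_chart_source p := mem_sliceChartAt_source p
  chart_mem_atlas p := ⟨_, isSliceChart_sliceChartAt p, p, rfl⟩

theorem restrChart_mem_atlas {φ : OpenPartialHomeomorph M E}
    (hφ : IsSliceChart E₀ S.carrier φ) (p : S) : restrChart hφ p ∈ atlas E₀ S :=
  ⟨φ, hφ, p, rfl⟩

theorem contDiffOn_transition [IsManifold 𝓘(ℝ, E) ∞ M] {φ₁ φ₂ : OpenPartialHomeomorph M E}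
    (h₁ : IsSliceChart E₀ S.carrier φ₁) (h₂ : IsSliceChart E₀ S.carrier φ₂) :
    ContDiffOn ℝ ∞ (φ₂ ∘ φ₁.symm) (φ₁.symm ≫ₕ φ₂).source := by
  have := (contMDiffOn_of_mem_maximalAtlas h₂.mem_maximalAtlas).comp'
    (contMDiffOn_symm_of_mem_maximalAtlas h₁.mem_maximalAtlas)
  rw [contMDiffOn_iff_contDiffOn] at this
  exact this

instance [IsManifold 𝓘(ℝ, E) ∞ M] : IsManifold 𝓘(ℝ, E₀) ∞ S := by
  apply isManifold_of_contDiffOn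
  rintro _ _ ⟨φ₁, h₁, p₁, rfl⟩ ⟨φ₂, h₂, p₂, rfl⟩
  have h := (S.proj.contDiff.comp_contDiffOn (contDiffOn_transition h₁ h₂)).comp
    (E₀.subtypeL.contDiff (n := ∞)).contDiffOn
    (s := ((restrChart h₁ p₁).symm ≫ₕ restrChart h₂ p₂).source) (by
      intro y hy
      refine ⟨hy.1, ?_⟩
      have := hy.2
      change ((restrChart h₁ p₁).symm y : M) ∈ φ₂.source at this
      rwa [coe_restrChart_symm_apply h₁ p₁ hy.1] at this)
  refine (h.congr ?_).mono (by intro y hy; simpa using hy.1)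
  intro y hy
  change S.proj (φ₂ ((restrChart h₁ p₁).symm y : M)) = _
  rw [coe_restrChart_symm_apply h₁ p₁ hy.1]
  rfl

/-! ### The normal bundle -/

variable (S) in
/-- The tangent space of the submanifold `S` at `p`, as a subspace of the tangent space of `M`: the
range of the differential at `p` of the inclusion of `S` in `M`. -/
def tangentSubspace (p : S) : Submodule ℝ (TangentSpace 𝓘(ℝ, E) (p : M)) :=
  (mfderiv 𝓘(ℝ, E₀) 𝓘(ℝ, E) (Subtype.val : S → M) p).range

variable (S) in
/-- The normal space `T_p M / T_p S` of the submanifold `S` at `p`, with the quotient topology. -/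
abbrev NormalSpace (p : S) : Type _ := TangentSpace 𝓘(ℝ, E) (p : M) ⧸ S.tangentSubspace p

theorem _root_.IsSliceChart.mdifferentiable [IsManifold 𝓘(ℝ, E) ∞ M] {φ : OpenPartialHomeomorph M E}
    (hφ : IsSliceChart E₀ S.carrier φ) : φ.MDifferentiable 𝓘(ℝ, E) 𝓘(ℝ, E) :=
  ⟨(contMDiffOn_of_mem_maximalAtlas hφ.mem_maximalAtlas).mdifferentiableOn (by simp),
    (contMDiffOn_symm_of_mem_maximalAtlas hφ.mem_maximalAtlas).mdifferentiableOn (by simp)⟩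

variable (S) in
/-- The linear section of `E → E / E₀` given by the projection of `E` onto `E₀`. -/
def quotSection : E ⧸ E₀ →L[ℝ] E :=
  E₀.liftQL (1 - E₀.subtypeL.comp S.proj) fun x hx => by
    simp [S.coe_proj hx]

theorem mkQL_quotSection (w : E ⧸ E₀) : E₀.mkQL (S.quotSection w) = w := by
  obtain ⟨x, rfl⟩ := E₀.mkQ_surjective w
  change E₀.mkQ (x - (S.proj x : E)) = E₀.mkQ x
  rw [map_sub, sub_eq_self, Submodule.mkQ_apply, Submodule.Quotient.mk_eq_zero]
  exact (S.proj x).2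

section

variable [IsManifold 𝓘(ℝ, E) ∞ M]

theorem contMDiff_val : ContMDiff 𝓘(ℝ, E₀) 𝓘(ℝ, E) ∞ (Subtype.val : S → M) := by
  intro p
  have hφ := isSliceChart_sliceChartAt p
  have hp := mem_sliceChartAt_source p
  set φ := S.sliceChartAt p
  have hr := contMDiffAt_of_mem_maximalAtlas (I := 𝓘(ℝ, E₀)) (n := ∞)
    (IsManifold.subset_maximalAtlas (restrChart_mem_atlas hφ p)) (x := p) hp
  have h1 : ContMDiffAt 𝓘(ℝ, E₀) 𝓘(ℝ, E) ∞ (fun x : S => (restrChart hφ p x : E)) p :=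
    (E₀.subtypeL.contDiff.contMDiff.contMDiffAt).comp p hr
  have hpt : (restrChart hφ p p : E) ∈ φ.target := by
    rw [coe_restrChart_apply hφ p hp]; exact φ.map_source hp
  have h2 : ContMDiffAt 𝓘(ℝ, E) 𝓘(ℝ, E) ∞ φ.symm (restrChart hφ p p : E) :=
    (contMDiffOn_symm_of_mem_maximalAtlas hφ.mem_maximalAtlas).contMDiffAt
      (φ.open_target.mem_nhds hpt)
  refine (h2.comp p h1).congr_of_eventuallyEq ?_
  filter_upwards [(φ.open_source.preimage continuous_subtype_val).mem_nhds hp] with x hx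
  simp only [Function.comp_apply]
  rw [coe_restrChart_apply hφ p hx, φ.left_inv hx]

/-- In a slice chart, the tangent space of `S` is `E₀`. -/
theorem map_tangentSubspace {φ : OpenPartialHomeomorph M E}
    (hφ : IsSliceChart E₀ S.carrier φ) {p : S} (hp : (p : M) ∈ φ.source) :
    (S.tangentSubspace p).map
      (hφ.mdifferentiable.mfderiv hp).toLinearEquiv.toLinearMap = E₀ := by
  have hr : (restrChart hφ p).MDifferentiable 𝓘(ℝ, E₀) 𝓘(ℝ, E₀) :=
    mdifferentiable_of_mem_atlas (restrChart_mem_atlas hφ p)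
  have hv : MDifferentiableAt 𝓘(ℝ, E₀) 𝓘(ℝ, E) (Subtype.val : S → M) p :=
    contMDiff_val.mdifferentiable (by simp) p
  have e1 : mfderiv 𝓘(ℝ, E₀) 𝓘(ℝ, E) (φ ∘ (Subtype.val : S → M)) p =
      (mfderiv 𝓘(ℝ, E) 𝓘(ℝ, E) φ (p : M)).comp
        (mfderiv 𝓘(ℝ, E₀) 𝓘(ℝ, E) (Subtype.val : S → M) p) :=
    mfderiv_comp p (hφ.mdifferentiable.mdifferentiableAt hp) hv
  have e2 : mfderiv 𝓘(ℝ, E₀) 𝓘(ℝ, E) (E₀.subtypeL ∘ restrChart hφ p) p =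
      (mfderiv 𝓘(ℝ, E₀) 𝓘(ℝ, E) E₀.subtypeL (restrChart hφ p p)).comp
        (mfderiv 𝓘(ℝ, E₀) 𝓘(ℝ, E₀) (restrChart hφ p) p) :=
    mfderiv_comp p E₀.subtypeL.differentiableAt.mdifferentiableAt (hr.mdifferentiableAt hp)
  have e3 : (φ ∘ (Subtype.val : S → M)) =ᶠ[𝓝 p] (E₀.subtypeL ∘ restrChart hφ p) := by
    filter_upwards [(φ.open_source.preimage continuous_subtype_val).mem_nhds hp] with x hx
    exact (coe_restrChart_apply hφ p hx).symm
  have e4 : mfderiv 𝓘(ℝ, E₀) 𝓘(ℝ, E) E₀.subtypeL (restrChart hφ p p) = E₀.subtypeL := by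
    rw [mfderiv_eq_fderiv]; exact E₀.subtypeL.fderiv
  have e5 := e1.symm.trans (e3.mfderiv_eq.trans e2)
  have hsurj := hr.mfderiv_surjective (x := p) hp
  have key : ∀ v, (mfderiv 𝓘(ℝ, E) 𝓘(ℝ, E) φ (p : M))
      (mfderiv 𝓘(ℝ, E₀) 𝓘(ℝ, E) (Subtype.val : S → M) p v) =
      E₀.subtypeL (mfderiv 𝓘(ℝ, E₀) 𝓘(ℝ, E₀) (restrChart hφ p) p v) := by
    intro v
    have := congrArg (fun L => L v) e5
    rw [e4] at this
    exact this
  ext w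
  constructor
  · rintro ⟨_, ⟨v, rfl⟩, rfl⟩
    have := key v
    change mfderiv 𝓘(ℝ, E) 𝓘(ℝ, E) φ (p : M) _ ∈ E₀
    exact this ▸ Subtype.prop (p := fun x => x ∈ E₀)
      (mfderiv 𝓘(ℝ, E₀) 𝓘(ℝ, E₀) (restrChart hφ p) p v)
  · intro hw
    obtain ⟨v, hv⟩ := hsurj (⟨w, hw⟩ : E₀)
    refine ⟨_, ⟨v, rfl⟩, (key v).trans ?_⟩
    rw [hv]
    rfl

/-- The isomorphism `T_p M / T_p S ≅ E / E₀` induced by the differential of a slice chart. -/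
def normalEquiv {φ : OpenPartialHomeomorph M E}
    (hφ : IsSliceChart E₀ S.carrier φ) {p : S} (hp : (p : M) ∈ φ.source) :
    S.NormalSpace p ≃L[ℝ] E ⧸ E₀ where
  toLinearEquiv := Submodule.Quotient.equiv (S.tangentSubspace p) E₀
    (hφ.mdifferentiable.mfderiv hp).toLinearEquiv (map_tangentSubspace hφ hp)
  continuous_toFun := by
    refine (S.tangentSubspace p).isQuotientMap_mkQ.continuous_iff.2 ?_
    exact continuous_quot_mk.comp (hφ.mdifferentiable.mfderiv hp).continuous
  continuous_invFun := by
    refine E₀.isQuotientMap_mkQ.continuous_iff.2 ?_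
    exact continuous_quot_mk.comp (hφ.mdifferentiable.mfderiv hp).symm.continuous

theorem normalEquiv_mk {φ : OpenPartialHomeomorph M E}
    (hφ : IsSliceChart E₀ S.carrier φ) {p : S} (hp : (p : M) ∈ φ.source)
    (v : TangentSpace 𝓘(ℝ, E) (p : M)) :
    normalEquiv hφ hp (Submodule.Quotient.mk v) =
      E₀.mkQL (mfderiv 𝓘(ℝ, E) 𝓘(ℝ, E) φ (p : M) v) := rfl

variable (S) in
/-- The change of coordinates of the normal bundle between two slice charts: the map induced on
`E / E₀` by the differential of the transition map. -/
def normalCoordChange [IsClosed (E₀ : Set E)] (φ₁ φ₂ : OpenPartialHomeomorph M E) (p : S) :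
    E ⧸ E₀ →L[ℝ] E ⧸ E₀ :=
  E₀.mkQL ∘L fderiv ℝ (φ₂ ∘ φ₁.symm) (φ₁ p) ∘L S.quotSection

theorem normalCoordChange_apply [IsClosed (E₀ : Set E)] {φ₁ φ₂ : OpenPartialHomeomorph M E}
    (h₁ : IsSliceChart E₀ S.carrier φ₁) (h₂ : IsSliceChart E₀ S.carrier φ₂) {p : S}
    (hp₁ : (p : M) ∈ φ₁.source) (hp₂ : (p : M) ∈ φ₂.source) (w : E ⧸ E₀) :
    S.normalCoordChange φ₁ φ₂ p w = normalEquiv h₂ hp₂ ((normalEquiv h₁ hp₁).symm w) := by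
  set v : TangentSpace 𝓘(ℝ, E) (p : M) :=
    (h₁.mdifferentiable.mfderiv hp₁).symm (S.quotSection w) with hv
  have hv' : mfderiv 𝓘(ℝ, E) 𝓘(ℝ, E) φ₁ (p : M) v = S.quotSection w :=
    (h₁.mdifferentiable.mfderiv hp₁).apply_symm_apply (S.quotSection w)
  have e : (normalEquiv h₁ hp₁).symm w = Submodule.Quotient.mk v := by
    rw [ContinuousLinearEquiv.symm_apply_eq, normalEquiv_mk, hv', mkQL_quotSection]
  rw [e, normalEquiv_mk]
  have hq : φ₁.symm (φ₁ p) = (p : M) := φ₁.left_inv hp₁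
  have hd : MDifferentiableAt 𝓘(ℝ, E) 𝓘(ℝ, E) (φ₂ ∘ φ₁.symm) (φ₁ (p : M)) := by
    refine MDifferentiableAt.comp _ ?_
      (h₁.mdifferentiable.mdifferentiableAt_symm (φ₁.map_source hp₁))
    rw [hq]
    exact h₂.mdifferentiable.mdifferentiableAt hp₂
  have e1 : mfderiv 𝓘(ℝ, E) 𝓘(ℝ, E) ((φ₂ ∘ φ₁.symm) ∘ φ₁) (p : M) =
      (mfderiv 𝓘(ℝ, E) 𝓘(ℝ, E) (φ₂ ∘ φ₁.symm) (φ₁ (p : M))).comp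
        (mfderiv 𝓘(ℝ, E) 𝓘(ℝ, E) φ₁ (p : M)) :=
    mfderiv_comp (p : M) hd (h₁.mdifferentiable.mdifferentiableAt hp₁)
  have e2 : ((φ₂ ∘ φ₁.symm) ∘ φ₁) =ᶠ[𝓝 (p : M)] φ₂ := by
    filter_upwards [φ₁.open_source.mem_nhds hp₁] with x hx
    simp only [Function.comp_apply]
    rw [φ₁.left_inv hx]
  have e3 := congrArg (fun L => L v) (e2.mfderiv_eq.symm.trans e1)
  have e4 : mfderiv 𝓘(ℝ, E) 𝓘(ℝ, E) φ₂ (p : M) v =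
      fderiv ℝ (φ₂ ∘ φ₁.symm) (φ₁ (p : M)) (S.quotSection w) := by
    rw [← hv', ← mfderiv_eq_fderiv]
    exact e3
  exact congrArg E₀.mkQL e4.symm

theorem contMDiffOn_normalCoordChange [IsClosed (E₀ : Set E)] {φ₁ φ₂ : OpenPartialHomeomorph M E}
    (h₁ : IsSliceChart E₀ S.carrier φ₁) (h₂ : IsSliceChart E₀ S.carrier φ₂) :
    ContMDiffOn 𝓘(ℝ, E₀) 𝓘(ℝ, E ⧸ E₀ →L[ℝ] E ⧸ E₀) ∞ (S.normalCoordChange φ₁ φ₂)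
      (Subtype.val ⁻¹' φ₁.source ∩ Subtype.val ⁻¹' φ₂.source) := by
  have hd : ContDiffOn ℝ ∞ (fderiv ℝ (φ₂ ∘ φ₁.symm)) (φ₁.symm ≫ₕ φ₂).source :=
    (contDiffOn_transition h₁ h₂).fderiv_of_isOpen (φ₁.symm ≫ₕ φ₂).open_source (by simp)
  have hd' : ContDiffOn ℝ ∞
      (fun x => E₀.mkQL ∘L fderiv ℝ (φ₂ ∘ φ₁.symm) x ∘L S.quotSection)
      (φ₁.symm ≫ₕ φ₂).source :=
    contDiffOn_const.clm_comp (hd.clm_comp contDiffOn_const)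
  refine hd'.contMDiffOn.comp
    (((contMDiffOn_of_mem_maximalAtlas h₁.mem_maximalAtlas).comp contMDiff_val.contMDiffOn
      fun x hx => hx).mono inter_subset_left) ?_
  intro p hp
  refine ⟨φ₁.map_source hp.1, ?_⟩
  change φ₁.symm (φ₁ p) ∈ φ₂.source
  rw [φ₁.left_inv hp.1]
  exact hp.2

open Classical in
/-- The local trivialization of the normal bundle given by a slice chart `φ`: the normal vector
`[v]` at `p` is sent to `(p, [Dφ(p) v])`. -/
def normalTrivialization [IsClosed (E₀ : Set E)] {φ : OpenPartialHomeomorph M E}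
    (hφ : IsSliceChart E₀ S.carrier φ) :
    Pretrivialization (E ⧸ E₀) (π (E ⧸ E₀) S.NormalSpace) where
  toFun z := (z.1, if h : (z.1 : M) ∈ φ.source then normalEquiv hφ h z.2 else 0)
  invFun z := ⟨z.1, if h : (z.1 : M) ∈ φ.source then (normalEquiv hφ h).symm z.2 else 0⟩
  source := π (E ⧸ E₀) S.NormalSpace ⁻¹' (Subtype.val ⁻¹' φ.source)
  target := (Subtype.val ⁻¹' φ.source) ×ˢ univ
  map_source' z hz := ⟨hz, mem_univ _⟩
  map_target' z hz := hz.1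
  left_inv' z hz := by
    have hz' : (z.1 : M) ∈ φ.source := hz
    simp [hz']
  right_inv' z hz := by
    have hz' : (z.1 : M) ∈ φ.source := hz.1
    simp [hz']
  open_target := (φ.open_source.preimage continuous_subtype_val).prod isOpen_univ
  baseSet := Subtype.val ⁻¹' φ.source
  open_baseSet := φ.open_source.preimage continuous_subtype_val
  source_eq := rfl
  target_eq := rfl
  proj_toFun _ _ := rfl

theorem normalTrivialization_apply [IsClosed (E₀ : Set E)] {φ : OpenPartialHomeomorph M E}
    (hφ : IsSliceChart E₀ S.carrier φ) {p : S} (hp : (p : M) ∈ φ.source) (v : S.NormalSpace p) :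
    normalTrivialization hφ ⟨p, v⟩ = (p, normalEquiv hφ hp v) :=
  Prod.ext rfl (dif_pos hp)

theorem normalTrivialization_symm_apply [IsClosed (E₀ : Set E)] {φ : OpenPartialHomeomorph M E}
    (hφ : IsSliceChart E₀ S.carrier φ) {p : S} (hp : (p : M) ∈ φ.source) (w : E ⧸ E₀) :
    (normalTrivialization hφ).symm p w = (normalEquiv hφ hp).symm w := by
  have h := (normalTrivialization hφ).apply_mk_symm (b := p) hp w
  rw [normalTrivialization_apply hφ hp] at h
  rw [ContinuousLinearEquiv.eq_symm_apply]
  exact (Prod.ext_iff.1 h).2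

variable (S) in
/-- The normal bundle of `S` as a vector bundle, with the local trivializations given by all slice
charts. -/
def normalPrebundle [IsClosed (E₀ : Set E)] : VectorPrebundle ℝ (E ⧸ E₀) S.NormalSpace where
  pretrivializationAtlas := {e | ∃ (φ : OpenPartialHomeomorph M E)
    (hφ : IsSliceChart E₀ S.carrier φ), e = normalTrivialization hφ}
  pretrivialization_linear' := by
    rintro _ ⟨φ, hφ, rfl⟩
    refine ⟨fun p hp => ⟨fun v w => ?_, fun c v => ?_⟩⟩
    all_goals
      have hp' : (p : M) ∈ φ.source := hp
      simp only [normalTrivialization_apply hφ hp']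
      simp
  pretrivializationAt p := normalTrivialization (isSliceChart_sliceChartAt p)
  mem_base_pretrivializationAt p := mem_sliceChartAt_source p
  pretrivialization_mem_atlas p := ⟨_, isSliceChart_sliceChartAt p, rfl⟩
  exists_coordChange := by
    rintro _ ⟨φ₁, h₁, rfl⟩ _ ⟨φ₂, h₂, rfl⟩
    refine ⟨S.normalCoordChange φ₁ φ₂, (contMDiffOn_normalCoordChange h₁ h₂).continuousOn, ?_⟩
    intro p hp w
    rw [normalTrivialization_symm_apply h₁ hp.1, normalTrivialization_apply h₂ hp.2,
      normalCoordChange_apply h₁ h₂ hp.1 hp.2]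
  totalSpaceMk_isInducing p := by
    have hp := mem_sliceChartAt_source p
    have e : normalTrivialization (isSliceChart_sliceChartAt p) ∘
        (TotalSpace.mk p : S.NormalSpace p → TotalSpace (E ⧸ E₀) S.NormalSpace) =
        fun v => (p, normalEquiv (isSliceChart_sliceChartAt p) hp v) :=
      funext fun v => normalTrivialization_apply _ hp v
    rw [e]
    exact (isInducing_const_prod.2
      (normalEquiv (isSliceChart_sliceChartAt p) hp).toHomeomorph.isInducing)

variable (S) in
/-- The normal bundle `ν(M, S) = TM|_S / TS` of the submanifold `S` of `M` (its total space, whose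
elements are pairs of a point `p` of `S` and a class in `T_p M / T_p S`). -/
abbrev NormalBundle : Type _ := TotalSpace (E ⧸ E₀) S.NormalSpace

instance [IsClosed (E₀ : Set E)] : TopologicalSpace S.NormalBundle :=
  S.normalPrebundle.totalSpaceTopology

instance [IsClosed (E₀ : Set E)] : FiberBundle (E ⧸ E₀) S.NormalSpace :=
  S.normalPrebundle.toFiberBundle

instance [IsClosed (E₀ : Set E)] : VectorBundle ℝ (E ⧸ E₀) S.NormalSpace :=
  S.normalPrebundle.toVectorBundle

instance [IsClosed (E₀ : Set E)] : S.normalPrebundle.IsContMDiff 𝓘(ℝ, E₀) ∞ := by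
  refine ⟨?_⟩
  rintro _ ⟨φ₁, h₁, rfl⟩ _ ⟨φ₂, h₂, rfl⟩
  refine ⟨S.normalCoordChange φ₁ φ₂, contMDiffOn_normalCoordChange h₁ h₂, ?_⟩
  intro p hp w
  rw [normalTrivialization_symm_apply h₁ hp.1, normalTrivialization_apply h₂ hp.2,
    normalCoordChange_apply h₁ h₂ hp.1 hp.2]

instance [IsClosed (E₀ : Set E)] : ContMDiffVectorBundle ∞ (E ⧸ E₀) S.NormalSpace 𝓘(ℝ, E₀) :=
  S.normalPrebundle.contMDiffVectorBundle 𝓘(ℝ, E₀)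

end

end EmbeddedSubmanifold

end

/-! A slice chart, or any chart in the case of `TM`, induces a bundle chart: `(p, v)` goes to `(φ p,
Dφ(p) v)`, with `v` replaced by its class for the normal bundle. Transition maps of such charts have
the form `(x, w) ↦ (f x, L x w)`. The differential at `(x, w)` is block triangular, with diagonal
blocks `Df(x)` and `L x` and off-diagonal block `u ↦ (DL(x) u) w`. Since transition maps are
diffeomorphisms, invertibility is automatic (`isUnit_fderiv_comp_symm`), so only compactness of the
diagonal blocks minus the identity and of the off-diagonal block is at stake
(`isCompactOperator_fderiv_fiberwiseLinear_sub_one`).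

Let `F` be the transition map of `M`. For `TM`, `f = F` and `L = DF`, so the diagonal is given. The
off-diagonal block is `u ↦ D²F(x)(u, w)`. By symmetry of the second derivative it is the derivative
of `DF` in the direction `w`, a norm limit of difference quotients of the compact operators `DF -
1`, hence compact (`isCompactOperator_fderiv_fderiv_flip`).

For the normal bundle, let `P` be the projection onto `E₀`, `ι` the inclusion, `q` the quotient map
and `s` its section. Then `f = P ∘ F ∘ ι` and `L = q ∘ DF ∘ s`. Because `P ∘ ι = 1` and `q ∘ s = 1`,
all three blocks are obtained from the compact operators above by composing with bounded ones. -/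

open Filter

/-! ### Compactness of second derivatives and of differentials of fibrewise linear maps -/

section Calculus

variable {E F : Type*} [NormedAddCommGroup E] [NormedSpace ℝ E]
  [NormedAddCommGroup F] [NormedSpace ℝ F]

/-- `GL_K(E)` is closed under composition. -/
theorem GLK_comp_mem {T₁ T₂ : E →L[ℝ] E} (h₁ : T₁ ∈ GLK E) (h₂ : T₂ ∈ GLK E) :
    T₁ ∘L T₂ ∈ GLK E := by
  refine ⟨h₁.1.mul h₂.1, ?_⟩
  have e : (T₁ ∘L T₂ - 1 : E →L[ℝ] E) = (T₁ - 1) ∘L T₂ + (T₂ - 1) := by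
    ext x; simp
  rw [e]
  exact (IsCompactOperator.comp_clm h₁.2 T₂).add h₂.2

/-- If the differentials of a `C^2` map are compact perturbations of the identity, then the second
differential in a fixed direction is a compact operator. -/
theorem isCompactOperator_fderiv_fderiv_flip [CompleteSpace E] {f : E → E} {x : E}
    (hf : ContDiffAt ℝ 2 f x)
    (hc : ∀ᶠ y in 𝓝 x, IsCompactOperator (fderiv ℝ f y - 1 : E →L[ℝ] E)) (v : E) :
    IsCompactOperator ((fderiv ℝ (fderiv ℝ f) x).flip v) := by
  -- In the flipped form the direction of differentiation varies, which gives no limit of compact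
  -- operators. Symmetry fixes that direction as `v`.
  have hsymm : (fderiv ℝ (fderiv ℝ f) x).flip v = fderiv ℝ (fderiv ℝ f) x v := by
    ext w
    exact hf.isSymmSndFDerivAt (by simp) w v
  rw [hsymm]
  have hd : DifferentiableAt ℝ (fderiv ℝ f) x :=
    (hf.fderiv_right (m := 1) (by norm_num)).differentiableAt (by simp)
  have hlim := hd.hasFDerivAt.hasLineDerivAt v |>.tendsto_slope_zero
  -- Compact operators into a complete space are closed in operator norm, so it suffices to treat
  -- the difference quotients.
  refine isCompactOperator_of_tendsto hlim ?_
  have hcont : Tendsto (fun t : ℝ => x + t • v) (𝓝[≠] 0) (𝓝 x) := by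
    have : Continuous fun t : ℝ => x + t • v := by fun_prop
    exact (this.tendsto' 0 x (by simp)).mono_left nhdsWithin_le_nhds
  filter_upwards [hcont.eventually hc] with t ht
  -- The two identities cancel in the difference.
  have h := (ht.sub hc.self_of_nhds).smul t⁻¹
  simpa using h

/-- The differential at `(x, w)` of a map that is locally of the form `(x, w) ↦ (f x, L x w)` is a
compact perturbation of the identity if `Df(x)` and `L x` are, and the differential of
`y ↦ L y w` at `x` is compact. -/
theorem isCompactOperator_fderiv_fiberwiseLinear_sub_one {G : E × F → E × F} {f : E → E}
    {L : E → F →L[ℝ] F} {x : E} {w : F} (hG : G =ᶠ[𝓝 (x, w)] fun z => (f z.1, L z.1 z.2))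
    (hf : DifferentiableAt ℝ f x) (hL : DifferentiableAt ℝ L x)
    (hfc : IsCompactOperator (fderiv ℝ f x - 1 : E →L[ℝ] E))
    (hLc : IsCompactOperator (L x - 1 : F →L[ℝ] F))
    (hLd : IsCompactOperator ((fderiv ℝ L x).flip w)) :
    IsCompactOperator (fderiv ℝ G (x, w) - 1 : E × F →L[ℝ] E × F) := by
  have h1 : HasFDerivAt (fun z : E × F => f z.1)
      ((fderiv ℝ f x) ∘L ContinuousLinearMap.fst ℝ E F) (x, w) :=
    HasFDerivAt.comp (g := f) (x, w) hf.hasFDerivAt hasFDerivAt_fst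
  have h2 : HasFDerivAt (fun z : E × F => L z.1)
      ((fderiv ℝ L x) ∘L ContinuousLinearMap.fst ℝ E F) (x, w) :=
    HasFDerivAt.comp (g := L) (x, w) hL.hasFDerivAt hasFDerivAt_fst
  have h3 := h1.prodMk (h2.clm_apply (hasFDerivAt_snd (𝕜 := ℝ) (p := (x, w))))
  rw [hG.fderiv_eq, h3.fderiv]
  -- The block matrix minus the identity is a sum of three terms, each factoring through one of the
  -- compact operators.
  have e : ((fderiv ℝ f x ∘L ContinuousLinearMap.fst ℝ E F).prod
      (L x ∘L ContinuousLinearMap.snd ℝ E F +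
        (fderiv ℝ L x ∘L ContinuousLinearMap.fst ℝ E F).flip w) - 1 : E × F →L[ℝ] E × F) =
      ContinuousLinearMap.inl ℝ E F ∘L (fderiv ℝ f x - 1) ∘L ContinuousLinearMap.fst ℝ E F +
      ContinuousLinearMap.inr ℝ E F ∘L ((L x - 1) ∘L ContinuousLinearMap.snd ℝ E F +
        (fderiv ℝ L x).flip w ∘L ContinuousLinearMap.fst ℝ E F) := by
    ext z <;> simp
  exact e ▸ ((hfc.comp_clm (ContinuousLinearMap.fst ℝ E F)).clm_comp
    (ContinuousLinearMap.inl ℝ E F)).add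
    (((hLc.comp_clm (ContinuousLinearMap.snd ℝ E F)).add
      (hLd.comp_clm (ContinuousLinearMap.fst ℝ E F))).clm_comp (ContinuousLinearMap.inr ℝ E F))

end Calculus

/-! ### Transition maps of Fredholm charts -/

section Transition

variable {V : Type*} [NormedAddCommGroup V] [NormedSpace ℝ V]
  {H : Type*} [TopologicalSpace H] {I : ModelWithCorners ℝ V H}
  {X : Type*} [TopologicalSpace X] [ChartedSpace H X]
  {φ₁ φ₂ : OpenPartialHomeomorph X V}

theorem contDiffOn_comp_symm (h₁ : ContMDiffOn 𝓘(ℝ, V) I ∞ φ₁.symm φ₁.target)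
    (h₂ : ContMDiffOn I 𝓘(ℝ, V) ∞ φ₂ φ₂.source) :
    ContDiffOn ℝ ∞ (φ₂ ∘ φ₁.symm) (φ₁.symm ≫ₕ φ₂).source := by
  rw [← contMDiffOn_iff_contDiffOn]
  exact h₂.comp' h₁

/-- The two transition maps are mutually inverse near the point, so by the chain rule their
differentials are inverse operators. This reduces membership in `GLK` to compactness. -/
theorem isUnit_fderiv_comp_symm
    (h₁ : ContMDiffOn I 𝓘(ℝ, V) ∞ φ₁ φ₁.source)
    (h₁' : ContMDiffOn 𝓘(ℝ, V) I ∞ φ₁.symm φ₁.target)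
    (h₂ : ContMDiffOn I 𝓘(ℝ, V) ∞ φ₂ φ₂.source)
    (h₂' : ContMDiffOn 𝓘(ℝ, V) I ∞ φ₂.symm φ₂.target)
    {p : X} (hp₁ : p ∈ φ₁.source) (hp₂ : p ∈ φ₂.source) :
    IsUnit (fderiv ℝ (φ₂ ∘ φ₁.symm) (φ₁ p)) := by
  -- Stated for arbitrary charts so that exchanging them yields both one-sided inverses.
  have aux : ∀ {φ ψ : OpenPartialHomeomorph X V},
      ContDiffOn ℝ ∞ (ψ ∘ φ.symm) (φ.symm ≫ₕ ψ).source →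
      ContDiffOn ℝ ∞ (φ ∘ ψ.symm) (ψ.symm ≫ₕ φ).source → p ∈ φ.source → p ∈ ψ.source →
      fderiv ℝ (φ ∘ ψ.symm) (ψ p) * fderiv ℝ (ψ ∘ φ.symm) (φ p) = 1 := by
    intro φ ψ h h' hφ hψ
    have m : φ p ∈ (φ.symm ≫ₕ ψ).source := ⟨φ.map_source hφ, by simpa [hφ] using hψ⟩
    have m' : ψ p ∈ (ψ.symm ≫ₕ φ).source := ⟨ψ.map_source hψ, by simpa [hψ] using hφ⟩
    have d := (h.contDiffAt ((φ.symm ≫ₕ ψ).open_source.mem_nhds m)).differentiableAt (by simp)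
    have d' := (h'.contDiffAt ((ψ.symm ≫ₕ φ).open_source.mem_nhds m')).differentiableAt (by simp)
    have e : (ψ ∘ φ.symm) (φ p) = ψ p := by simp [hφ]
    have key : fderiv ℝ ((φ ∘ ψ.symm) ∘ (ψ ∘ φ.symm)) (φ p) =
        fderiv ℝ (φ ∘ ψ.symm) (ψ p) * fderiv ℝ (ψ ∘ φ.symm) (φ p) := by
      rw [fderiv_comp _ (by rwa [e]) d, e]
      rfl
    rw [← key]
    have ev : ((φ ∘ ψ.symm) ∘ (ψ ∘ φ.symm)) =ᶠ[𝓝 (φ p)] id := by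
      filter_upwards [(φ.symm ≫ₕ ψ).open_source.mem_nhds m] with y hy
      simp only [Function.comp_apply]
      rw [ψ.left_inv (x := φ.symm y) hy.2, φ.right_inv hy.1, id]
    rw [ev.fderiv_eq, fderiv_id]
    rfl
  have c := contDiffOn_comp_symm h₁' h₂
  have c' := contDiffOn_comp_symm h₂' h₁
  exact ⟨⟨_, _, aux c' c hp₂ hp₁, aux c c' hp₁ hp₂⟩, rfl⟩

/-- An atlas whose transition maps have differentials that are compact perturbations of the identity
is a Fredholm atlas. -/
theorem IsFredholmAtlas.of_isCompactOperator {A : Set (OpenPartialHomeomorph X V)}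
    (covers : ∀ x : X, ∃ φ ∈ A, x ∈ φ.source)
    (smooth : ∀ φ ∈ A, ContMDiffOn I 𝓘(ℝ, V) ∞ φ φ.source)
    (smooth_symm : ∀ φ ∈ A, ContMDiffOn 𝓘(ℝ, V) I ∞ φ.symm φ.target)
    (compact : ∀ φ₁ ∈ A, ∀ φ₂ ∈ A, ∀ p ∈ φ₁.source, p ∈ φ₂.source →
      IsCompactOperator (fderiv ℝ (φ₂ ∘ φ₁.symm) (φ₁ p) - 1 : V →L[ℝ] V)) :
    IsFredholmAtlas I A where
  covers := covers
  smooth := smooth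
  smooth_symm := smooth_symm
  transition := by
    rintro φ₁ h₁ φ₂ h₂ _ ⟨p, ⟨hp₁, hp₂⟩, rfl⟩
    exact ⟨isUnit_fderiv_comp_symm (smooth _ h₁) (smooth_symm _ h₁) (smooth _ h₂)
      (smooth_symm _ h₂) hp₁ hp₂, compact _ h₁ _ h₂ p hp₁ hp₂⟩

/-- Two charts of which each can be added to a Fredholm atlas have a Fredholm transition map. -/
theorem IsFredholmAtlas.fderiv_comp_symm_mem_GLK {A : Set (OpenPartialHomeomorph X V)}
    (h₁ : IsFredholmAtlas I (insert φ₁ A)) (h₂ : IsFredholmAtlas I (insert φ₂ A))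
    (hA : IsFredholmAtlas I A) {p : X} (hp₁ : p ∈ φ₁.source) (hp₂ : p ∈ φ₂.source) :
    fderiv ℝ (φ₂ ∘ φ₁.symm) (φ₁ p) ∈ GLK V := by
  -- The two charts are not assumed to lie in a common Fredholm atlas, so the transition map is
  -- factored through a chart of `A`.
  obtain ⟨ψ, hψ, hp⟩ := hA.covers p
  have t₁ := h₁.transition φ₁ (mem_insert _ _) ψ (mem_insert_of_mem _ hψ) (φ₁ p) ⟨p, ⟨hp₁, hp⟩, rfl⟩
  have t₂ := h₂.transition ψ (mem_insert_of_mem _ hψ) φ₂ (mem_insert _ _) (ψ p) ⟨p, ⟨hp, hp₂⟩, rfl⟩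
  have c₁ := contDiffOn_comp_symm (h₁.smooth_symm φ₁ (mem_insert _ _)) (hA.smooth ψ hψ)
  have c₂ := contDiffOn_comp_symm (hA.smooth_symm ψ hψ) (h₂.smooth φ₂ (mem_insert _ _))
  have m₁ : φ₁ p ∈ (φ₁.symm ≫ₕ ψ).source := ⟨φ₁.map_source hp₁, by simpa [hp₁] using hp⟩
  have m₂ : ψ p ∈ (ψ.symm ≫ₕ φ₂).source := ⟨ψ.map_source hp, by simpa [hp] using hp₂⟩
  have d₁ := (c₁.contDiffAt ((φ₁.symm ≫ₕ ψ).open_source.mem_nhds m₁)).differentiableAt (by simp)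
  have d₂ := (c₂.contDiffAt ((ψ.symm ≫ₕ φ₂).open_source.mem_nhds m₂)).differentiableAt (by simp)
  have e : (ψ ∘ φ₁.symm) (φ₁ p) = ψ p := by simp [hp₁]
  have ev : (φ₂ ∘ φ₁.symm) =ᶠ[𝓝 (φ₁ p)] ((φ₂ ∘ ψ.symm) ∘ (ψ ∘ φ₁.symm)) := by
    filter_upwards [(φ₁.symm ≫ₕ ψ).open_source.mem_nhds m₁] with y hy
    simp only [Function.comp_apply]
    rw [ψ.left_inv (x := φ₁.symm y) hy.2]
  rw [ev.fderiv_eq, fderiv_comp _ (by rwa [e]) d₁, e]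
  exact GLK_comp_mem t₂ t₁

end Transition

/-! ### The tangent bundle -/

section TangentBundle

variable {E : Type*} [NormedAddCommGroup E] [NormedSpace ℝ E]
  {M : Type*} [TopologicalSpace M] [ChartedSpace E M]

/-- The differential at `x` of the transition map between two charts. -/
theorem mfderiv_mfderiv_symm_apply {φ₁ φ₂ : OpenPartialHomeomorph M E}
    (h₁ : φ₁.MDifferentiable 𝓘(ℝ, E) 𝓘(ℝ, E)) (h₂ : φ₂.MDifferentiable 𝓘(ℝ, E) 𝓘(ℝ, E))
    {x : E} (hx : x ∈ (φ₁.symm ≫ₕ φ₂).source) (v : E) :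
    mfderiv 𝓘(ℝ, E) 𝓘(ℝ, E) φ₂ (φ₁.symm x) (mfderiv 𝓘(ℝ, E) 𝓘(ℝ, E) φ₁.symm x v) =
      fderiv ℝ (φ₂ ∘ φ₁.symm) x v := by
  have e : mfderiv 𝓘(ℝ, E) 𝓘(ℝ, E) (φ₂ ∘ φ₁.symm) x =
      (mfderiv 𝓘(ℝ, E) 𝓘(ℝ, E) φ₂ (φ₁.symm x)).comp (mfderiv 𝓘(ℝ, E) 𝓘(ℝ, E) φ₁.symm x) :=
    mfderiv_comp x (h₂.mdifferentiableAt hx.2) (h₁.mdifferentiableAt_symm hx.1)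
  rw [mfderiv_eq_fderiv] at e
  exact (congrArg (fun L => L v) e).symm

/-- Lets the tangent map of an inverse chart, defined on the tangent bundle of `E`, be read as a
smooth map on `E × E`. -/
theorem contMDiff_toTangentBundle :
    ContMDiff 𝓘(ℝ, E × E) 𝓘(ℝ, E).tangent ∞
      (fun y : E × E => (⟨y.1, y.2⟩ : TangentBundle 𝓘(ℝ, E) E)) := by
  have h := contMDiff_tangentBundleModelSpaceHomeomorph_symm (I := 𝓘(ℝ, E)) (n := ∞)
  rw [modelWithCornersSelf_prod]
  exact h

variable [IsManifold 𝓘(ℝ, E) ∞ M]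

/-- The second component is the fibre coordinate of the tangent map of `φ`, which is again smooth
because one derivative costs nothing at order `∞`. -/
theorem contMDiffOn_mfderiv_apply {φ : OpenPartialHomeomorph M E}
    (h : ContMDiffOn 𝓘(ℝ, E) 𝓘(ℝ, E) ∞ φ φ.source) :
    ContMDiffOn 𝓘(ℝ, E).tangent 𝓘(ℝ, E × E) ∞
      (fun z : TangentBundle 𝓘(ℝ, E) M =>
        ((φ z.1, mfderiv 𝓘(ℝ, E) 𝓘(ℝ, E) φ z.1 z.2) : E × E))
      (π E (TangentSpace 𝓘(ℝ, E)) ⁻¹' φ.source) := by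
  have : IsManifold 𝓘(ℝ, E) 1 M := IsManifold.of_le (n := ∞) (by simp)
  have h1 := h.contMDiffOn_tangentMapWithin (m := ∞) (by simp) φ.open_source.uniqueMDiffOn
  have h2 := (contMDiff_snd_tangentBundle_modelSpace E 𝓘(ℝ, E) (n := ∞)).comp_contMDiffOn h1
  refine (h.comp (contMDiffOn_proj (TangentSpace 𝓘(ℝ, E) (M := M))) fun _ hz => hz).prodMk_space
    (h2.congr fun z hz => ?_)
  exact congrArg (fun L : E →L[ℝ] E => L z.2) (mfderivWithin_of_isOpen φ.open_source hz).symm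

theorem contMDiffOn_mfderiv_symm_apply {φ : OpenPartialHomeomorph M E}
    (h : ContMDiffOn 𝓘(ℝ, E) 𝓘(ℝ, E) ∞ φ.symm φ.target) :
    ContMDiffOn 𝓘(ℝ, E × E) 𝓘(ℝ, E).tangent ∞
      (fun y : E × E =>
        (⟨φ.symm y.1, mfderiv 𝓘(ℝ, E) 𝓘(ℝ, E) φ.symm y.1 y.2⟩ : TangentBundle 𝓘(ℝ, E) M))
      (φ.target ×ˢ univ) := by
  have : IsManifold 𝓘(ℝ, E) 1 M := IsManifold.of_le (n := ∞) (by simp)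
  have h1 := h.contMDiffOn_tangentMapWithin (m := ∞) (by simp) φ.open_target.uniqueMDiffOn
  refine (h1.comp contMDiff_toTangentBundle.contMDiffOn fun y hy => hy.1).congr fun y hy => ?_
  simp only [Function.comp_apply, tangentMapWithin]
  rw [mfderivWithin_of_isOpen φ.open_target hy.1]

/-- The chart `(p, v) ↦ (φ p, Dφ(p) v)` of the tangent bundle given by a smooth chart `φ`. -/
noncomputable def tangentChart (φ : OpenPartialHomeomorph M E)
    (h : ContMDiffOn 𝓘(ℝ, E) 𝓘(ℝ, E) ∞ φ φ.source)
    (h' : ContMDiffOn 𝓘(ℝ, E) 𝓘(ℝ, E) ∞ φ.symm φ.target) :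
    OpenPartialHomeomorph (TangentBundle 𝓘(ℝ, E) M) (E × E) where
  toFun z := (φ z.1, mfderiv 𝓘(ℝ, E) 𝓘(ℝ, E) φ z.1 z.2)
  invFun y := ⟨φ.symm y.1, mfderiv 𝓘(ℝ, E) 𝓘(ℝ, E) φ.symm y.1 y.2⟩
  source := π E (TangentSpace 𝓘(ℝ, E)) ⁻¹' φ.source
  target := φ.target ×ˢ univ
  map_source' z hz := ⟨φ.map_source hz, mem_univ _⟩
  map_target' y hy := φ.map_target hy.1
  left_inv' := by
    rintro ⟨p, v⟩ hp
    have hd : φ.MDifferentiable 𝓘(ℝ, E) 𝓘(ℝ, E) :=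
      ⟨h.mdifferentiableOn (by simp), h'.mdifferentiableOn (by simp)⟩
    have hp' : p ∈ φ.source := hp
    have e := congrArg (fun L => L v) (hd.symm_comp_deriv hp')
    refine TotalSpace.ext (φ.left_inv hp') ?_
    -- The two vectors sit over different expressions for the base point, but every tangent space is
    -- `E` by definition.
    exact heq_of_eq e
  right_inv' := by
    rintro ⟨x, v⟩ hx
    have hd : φ.MDifferentiable 𝓘(ℝ, E) 𝓘(ℝ, E) :=
      ⟨h.mdifferentiableOn (by simp), h'.mdifferentiableOn (by simp)⟩
    exact Prod.ext (φ.right_inv hx.1) (congrArg (fun L => L v) (hd.comp_symm_deriv hx.1))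
  open_source := φ.open_source.preimage (FiberBundle.continuous_proj E (TangentSpace 𝓘(ℝ, E)))
  open_target := φ.open_target.prod isOpen_univ
  continuousOn_toFun := (contMDiffOn_mfderiv_apply h).continuousOn
  continuousOn_invFun := (contMDiffOn_mfderiv_symm_apply h').continuousOn

/-- The tangent bundle of a Fredholm manifold is a Fredholm manifold. -/
theorem IsFredholmAtlas.isFredholmManifold_tangentBundle [CompleteSpace E]
    {A : Set (OpenPartialHomeomorph M E)} (hA : IsFredholmAtlas 𝓘(ℝ, E) A) :
    IsFredholmManifold 𝓘(ℝ, E).tangent (TangentBundle 𝓘(ℝ, E) M) := by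
  refine ⟨inferInstance,
    {Φ | ∃ (φ : OpenPartialHomeomorph M E) (hφ : φ ∈ A),
      Φ = tangentChart φ (hA.smooth φ hφ) (hA.smooth_symm φ hφ)}, ?_⟩
  apply IsFredholmAtlas.of_isCompactOperator
  · intro z
    obtain ⟨φ, hφ, hz⟩ := hA.covers z.1
    exact ⟨_, ⟨φ, hφ, rfl⟩, hz⟩
  · rintro _ ⟨φ, hφ, rfl⟩
    exact contMDiffOn_mfderiv_apply (hA.smooth φ hφ)
  · rintro _ ⟨φ, hφ, rfl⟩
    exact contMDiffOn_mfderiv_symm_apply (hA.smooth_symm φ hφ)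
  · rintro _ ⟨φ₁, h₁, rfl⟩ _ ⟨φ₂, h₂, rfl⟩ ⟨p, v⟩ hp₁ hp₂
    have hp₁ : p ∈ φ₁.source := hp₁
    have hp₂ : p ∈ φ₂.source := hp₂
    have hd : ∀ φ ∈ A, φ.MDifferentiable 𝓘(ℝ, E) 𝓘(ℝ, E) := fun φ hφ =>
      ⟨(hA.smooth φ hφ).mdifferentiableOn (by simp),
        (hA.smooth_symm φ hφ).mdifferentiableOn (by simp)⟩
    have hU := (φ₁.symm ≫ₕ φ₂).open_source
    have hm : φ₁ p ∈ (φ₁.symm ≫ₕ φ₂).source := ⟨φ₁.map_source hp₁, by simpa [hp₁] using hp₂⟩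
    have hc := contDiffOn_comp_symm (hA.smooth_symm φ₁ h₁) (hA.smooth φ₂ h₂)
    have hF := hc.contDiffAt (hU.mem_nhds hm)
    -- A whole neighbourhood is needed, as the off-diagonal block is a limit of difference
    -- quotients.
    have hK : ∀ᶠ x in 𝓝 (φ₁ p), fderiv ℝ (φ₂ ∘ φ₁.symm) x ∈ GLK E := by
      filter_upwards [hU.mem_nhds hm] with x hx
      exact hA.transition φ₁ h₁ φ₂ h₂ x
        ⟨φ₁.symm x, ⟨φ₁.map_target hx.1, hx.2⟩, φ₁.right_inv hx.1⟩
    refine isCompactOperator_fderiv_fiberwiseLinear_sub_one (f := φ₂ ∘ φ₁.symm)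
      (L := fderiv ℝ (φ₂ ∘ φ₁.symm)) (x := φ₁ p) (w := mfderiv 𝓘(ℝ, E) 𝓘(ℝ, E) φ₁ p v) ?_
      (hF.differentiableAt (by simp))
      ((hF.fderiv_right (m := ∞) (by simp)).differentiableAt (by simp))
      hK.self_of_nhds.2 hK.self_of_nhds.2
      (isCompactOperator_fderiv_fderiv_flip (contDiffAt_infty.1 hF 2)
        (hK.mono fun x hx => hx.2) _)
    filter_upwards [(hU.preimage continuous_fst).mem_nhds hm] with z hz
    exact Prod.ext rfl (mfderiv_mfderiv_symm_apply (hd φ₁ h₁) (hd φ₂ h₂) hz z.2)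

end TangentBundle

/-! ### The normal bundle -/

section NormalBundle

namespace EmbeddedSubmanifold

variable {E : Type*} [NormedAddCommGroup E] [NormedSpace ℝ E]
  {M : Type*} [TopologicalSpace M] [ChartedSpace E M] [IsManifold 𝓘(ℝ, E) ∞ M]
  {E₀ : Submodule ℝ E} [IsClosed (E₀ : Set E)] {S : EmbeddedSubmanifold M E₀}

/-- The local trivialization of the normal bundle given by a slice chart. -/
noncomputable def sliceTrivialization {φ : OpenPartialHomeomorph M E}
    (hφ : IsSliceChart E₀ S.carrier φ) : Trivialization (E ⧸ E₀) (π (E ⧸ E₀) S.NormalSpace) :=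
  S.normalPrebundle.trivializationOfMemPretrivializationAtlas ⟨φ, hφ, rfl⟩

/-- Makes the smoothness of trivializations in a smooth vector bundle available for every slice
chart. -/
instance {φ : OpenPartialHomeomorph M E} (hφ : IsSliceChart E₀ S.carrier φ) :
    MemTrivializationAtlas (sliceTrivialization hφ) :=
  ⟨_, ⟨φ, hφ, rfl⟩, rfl⟩

/-- The chart of the normal bundle given by a slice chart `φ`: the class of `v` at `p` is sent to
`(φ p, [Dφ(p) v])`. -/
noncomputable def normalChart {φ : OpenPartialHomeomorph M E} (hφ : IsSliceChart E₀ S.carrier φ)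
    (p : S) : OpenPartialHomeomorph S.NormalBundle (E₀ × (E ⧸ E₀)) :=
  (sliceTrivialization hφ).toOpenPartialHomeomorph ≫ₕ
    (restrChart hφ p).prod (OpenPartialHomeomorph.refl (E ⧸ E₀))

theorem mem_normalChart_source {φ : OpenPartialHomeomorph M E}
    (hφ : IsSliceChart E₀ S.carrier φ) (p : S) (z : S.NormalBundle) :
    z ∈ (normalChart hφ p).source ↔ (z.1 : M) ∈ φ.source :=
  ⟨fun h => h.1, fun h => ⟨h, h, mem_univ _⟩⟩

theorem normalChart_apply {φ : OpenPartialHomeomorph M E} (hφ : IsSliceChart E₀ S.carrier φ)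
    (p : S) {q : S} (hq : (q : M) ∈ φ.source) (v : S.NormalSpace q) :
    normalChart hφ p ⟨q, v⟩ = (S.proj (φ q), normalEquiv hφ hq v) :=
  Prod.ext rfl (dif_pos hq)

theorem normalChart_symm_apply {φ : OpenPartialHomeomorph M E}
    (hφ : IsSliceChart E₀ S.carrier φ) (p : S) (y : E₀ × (E ⧸ E₀))
    (hq : ((restrChart hφ p).symm y.1 : M) ∈ φ.source) :
    (normalChart hφ p).symm y =
      ⟨(restrChart hφ p).symm y.1, (normalEquiv hφ hq).symm y.2⟩ :=
  TotalSpace.ext rfl (heq_of_eq (dif_pos hq))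

theorem contMDiffOn_normalChart {φ : OpenPartialHomeomorph M E}
    (hφ : IsSliceChart E₀ S.carrier φ) (p : S) :
    ContMDiffOn (𝓘(ℝ, E₀).prod 𝓘(ℝ, E ⧸ E₀)) 𝓘(ℝ, E₀ × (E ⧸ E₀)) ∞
      (normalChart hφ p) (normalChart hφ p).source := by
  have hr := contMDiffOn_of_mem_maximalAtlas (I := 𝓘(ℝ, E₀)) (n := ∞)
    (IsManifold.subset_maximalAtlas (restrChart_mem_atlas hφ p))
  have he := (sliceTrivialization hφ).contMDiffOn (IB := 𝓘(ℝ, E₀)) (n := ∞)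
  have h : ContMDiffOn (𝓘(ℝ, E₀).prod 𝓘(ℝ, E ⧸ E₀)) 𝓘(ℝ, E₀ × (E ⧸ E₀)) ∞
      (fun y : S × (E ⧸ E₀) => (restrChart hφ p y.1, y.2)) ((restrChart hφ p).source ×ˢ univ) :=
    (hr.comp contMDiffOn_fst fun y hy => hy.1).prodMk_space contMDiffOn_snd
  exact (h.comp' he).mono fun z hz => hz

theorem contMDiffOn_normalChart_symm {φ : OpenPartialHomeomorph M E}
    (hφ : IsSliceChart E₀ S.carrier φ) (p : S) :
    ContMDiffOn 𝓘(ℝ, E₀ × (E ⧸ E₀)) (𝓘(ℝ, E₀).prod 𝓘(ℝ, E ⧸ E₀)) ∞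
      (normalChart hφ p).symm (normalChart hφ p).target := by
  have hr := contMDiffOn_symm_of_mem_maximalAtlas (I := 𝓘(ℝ, E₀)) (n := ∞)
    (IsManifold.subset_maximalAtlas (restrChart_mem_atlas hφ p))
  have he := (sliceTrivialization hφ).contMDiffOn_symm (IB := 𝓘(ℝ, E₀)) (n := ∞)
  have h : ContMDiffOn 𝓘(ℝ, E₀ × (E ⧸ E₀)) (𝓘(ℝ, E₀).prod 𝓘(ℝ, E ⧸ E₀)) ∞
      (fun y : E₀ × (E ⧸ E₀) => ((restrChart hφ p).symm y.1, y.2))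
      ((restrChart hφ p).target ×ˢ univ) :=
    (hr.comp contDiff_fst.contMDiff.contMDiffOn fun y hy => hy.1).prodMk
      contDiff_snd.contMDiff.contMDiffOn
  exact (he.comp' h).mono fun z hz => hz

/-- The transition maps of the normal bundle. -/
theorem normalChart_comp_symm_apply {φ₁ φ₂ : OpenPartialHomeomorph M E}
    (h₁ : IsSliceChart E₀ S.carrier φ₁) (h₂ : IsSliceChart E₀ S.carrier φ₂) (p₁ p₂ : S)
    {y : E₀ × (E ⧸ E₀)} (hy : (y.1 : E) ∈ (φ₁.symm ≫ₕ φ₂).source) :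
    (normalChart h₂ p₂ ∘ (normalChart h₁ p₁).symm) y =
      (S.proj ((φ₂ ∘ φ₁.symm) y.1),
        (E₀.mkQL ∘L fderiv ℝ (φ₂ ∘ φ₁.symm) y.1 ∘L S.quotSection) y.2) := by
  have e := coe_restrChart_symm_apply h₁ p₁ hy.1
  have hq₁ : ((restrChart h₁ p₁).symm y.1 : M) ∈ φ₁.source := e ▸ φ₁.map_target hy.1
  have hq₂ : ((restrChart h₁ p₁).symm y.1 : M) ∈ φ₂.source := e ▸ hy.2
  rw [Function.comp_apply, normalChart_symm_apply h₁ p₁ y hq₁, normalChart_apply h₂ p₂ hq₂,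
    ← normalCoordChange_apply h₁ h₂ hq₁ hq₂, normalCoordChange, e, φ₁.right_inv hy.1]
  rfl

/-- The normal bundle of a Fredholm submanifold is a Fredholm manifold. -/
theorem isFredholmManifold_normalBundle [CompleteSpace E]
    {A : Set (OpenPartialHomeomorph M E)} (hA : IsFredholmAtlas 𝓘(ℝ, E) A)
    (hS : IsFredholmSubmanifold A S) :
    IsFredholmManifold (𝓘(ℝ, E₀).prod 𝓘(ℝ, E ⧸ E₀)) S.NormalBundle := by
  -- The atlas uses all slice charts that can be added to `A`; `A` itself need not contain any slice
  -- chart.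
  refine ⟨inferInstance, {Φ | ∃ (φ : OpenPartialHomeomorph M E)
    (hφ : IsSliceChart E₀ S.carrier φ) (p : S),
      IsFredholmAtlas 𝓘(ℝ, E) (insert φ A) ∧ Φ = normalChart hφ p}, ?_⟩
  apply IsFredholmAtlas.of_isCompactOperator
  · intro z
    obtain ⟨φ, hφ, hz, hφA⟩ := hS z.1 z.1.2
    exact ⟨_, ⟨φ, hφ, z.1, hφA, rfl⟩, (mem_normalChart_source hφ z.1 z).2 hz⟩
  · rintro _ ⟨φ, hφ, p, -, rfl⟩
    exact contMDiffOn_normalChart hφ p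
  · rintro _ ⟨φ, hφ, p, -, rfl⟩
    exact contMDiffOn_normalChart_symm hφ p
  · rintro _ ⟨φ₁, h₁, p₁, hA₁, rfl⟩ _ ⟨φ₂, h₂, p₂, hA₂, rfl⟩ ⟨q, v⟩ hq₁ hq₂
    rw [mem_normalChart_source] at hq₁ hq₂
    have hq₁ : (q : M) ∈ φ₁.source := hq₁
    have hq₂ : (q : M) ∈ φ₂.source := hq₂
    have hU := (φ₁.symm ≫ₕ φ₂).open_source
    have hx : (S.proj (φ₁ q) : E) = φ₁ q := coe_restrChart_apply h₁ q hq₁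
    rw [normalChart_apply h₁ p₁ hq₁]
    set x : E₀ := S.proj (φ₁ q)
    set w : E ⧸ E₀ := normalEquiv h₁ hq₁ v
    have hm : (x : E) ∈ (φ₁.symm ≫ₕ φ₂).source := by
      rw [hx]
      exact ⟨φ₁.map_source hq₁, by simpa [hq₁] using hq₂⟩
    have hF := (contDiffOn_transition h₁ h₂).contDiffAt (hU.mem_nhds hm)
    -- The neighbourhood is taken in `E`, not in `E₀`: the second derivative will be taken in the
    -- direction `S.quotSection w`, which is transverse to `E₀` when nonzero.
    have hK : ∀ᶠ y in 𝓝 (x : E),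
        IsCompactOperator (fderiv ℝ (φ₂ ∘ φ₁.symm) y - 1 : E →L[ℝ] E) := by
      filter_upwards [hU.mem_nhds hm] with y hy
      have := hA₁.fderiv_comp_symm_mem_GLK hA₂ hA (φ₁.map_target hy.1) hy.2
      rw [φ₁.right_inv hy.1] at this
      exact this.2
    have hf : HasFDerivAt (fun y : E₀ => S.proj ((φ₂ ∘ φ₁.symm) y))
        (S.proj ∘L fderiv ℝ (φ₂ ∘ φ₁.symm) x ∘L E₀.subtypeL) x :=
      S.proj.hasFDerivAt.comp x ((hF.differentiableAt (by simp)).hasFDerivAt.comp x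
        E₀.subtypeL.hasFDerivAt)
    have hD : HasFDerivAt (fun y : E₀ => fderiv ℝ (φ₂ ∘ φ₁.symm) y)
        (fderiv ℝ (fderiv ℝ (φ₂ ∘ φ₁.symm)) x ∘L E₀.subtypeL) x :=
      ((hF.fderiv_right (m := ∞) (by simp)).differentiableAt (by simp)).hasFDerivAt.comp x
        E₀.subtypeL.hasFDerivAt
    have hL := (hasFDerivAt_const E₀.mkQL x).clm_comp
      (hD.clm_comp (hasFDerivAt_const S.quotSection x))
    refine isCompactOperator_fderiv_fiberwiseLinear_sub_one
      (f := fun y : E₀ => S.proj ((φ₂ ∘ φ₁.symm) y))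
      (L := fun y : E₀ => E₀.mkQL ∘L fderiv ℝ (φ₂ ∘ φ₁.symm) y ∘L S.quotSection)
      ?_ hf.differentiableAt hL.differentiableAt ?_ ?_ ?_
    · filter_upwards [(hU.preimage (continuous_subtype_val.comp continuous_fst)).mem_nhds hm]
        with y hy
      exact normalChart_comp_symm_apply h₁ h₂ p₁ p₂ hy
    · rw [hf.fderiv]
      -- The identity of `E₀` is the projection composed with the inclusion, so it can be absorbed
      -- into the middle factor.
      have e : (S.proj ∘L fderiv ℝ (φ₂ ∘ φ₁.symm) x ∘L E₀.subtypeL - 1 : E₀ →L[ℝ] E₀) =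
          S.proj ∘L (fderiv ℝ (φ₂ ∘ φ₁.symm) x - 1) ∘L E₀.subtypeL := by
        ext u
        simp [S.proj_apply]
      exact e ▸ (hK.self_of_nhds.comp_clm E₀.subtypeL).clm_comp S.proj
    -- The same absorption, now because `S.quotSection` is a section of the quotient map.
    · have e : (E₀.mkQL ∘L fderiv ℝ (φ₂ ∘ φ₁.symm) x ∘L S.quotSection - 1 :
          E ⧸ E₀ →L[ℝ] E ⧸ E₀) =
          E₀.mkQL ∘L (fderiv ℝ (φ₂ ∘ φ₁.symm) x - 1) ∘L S.quotSection := by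
        refine ContinuousLinearMap.ext fun u => ?_
        have := mkQL_quotSection (S := S) u
        simp only [sub_apply, ContinuousLinearMap.comp_apply, map_sub,
          one_apply_eq_self, this]
      exact e ▸ (hK.self_of_nhds.comp_clm S.quotSection).clm_comp E₀.mkQL
    -- The off-diagonal block is the second derivative with one argument fixed at `S.quotSection w`,
    -- restricted to `E₀` and reduced modulo `E₀`.
    · have e : (fderiv ℝ (fun y : E₀ =>
          E₀.mkQL ∘L fderiv ℝ (φ₂ ∘ φ₁.symm) y ∘L S.quotSection) x).flip w =
          E₀.mkQL ∘L (fderiv ℝ (fderiv ℝ (φ₂ ∘ φ₁.symm)) x).flip (S.quotSection w) ∘L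
            E₀.subtypeL := by
        rw [hL.fderiv]
        refine ContinuousLinearMap.ext fun u => ?_
        simp
      exact e ▸ ((isCompactOperator_fderiv_fderiv_flip
        (contDiffAt_infty.1 hF 2) hK _).comp_clm
          E₀.subtypeL).clm_comp E₀.mkQL

end EmbeddedSubmanifold

end NormalBundle

theorem mainTheorem7 {E : Type*} [NormedAddCommGroup E] [NormedSpace ℝ E] [CompleteSpace E]
    {M : Type*} [TopologicalSpace M] [ChartedSpace E M] [IsManifold 𝓘(ℝ, E) ∞ M] :
    (∀ A : Set (OpenPartialHomeomorph M E), IsFredholmAtlas 𝓘(ℝ, E) A →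
      ∀ (E₀ : Submodule ℝ E) [IsClosed (E₀ : Set E)] (S : EmbeddedSubmanifold M E₀),
        IsFredholmSubmanifold A S →
          IsFredholmManifold (𝓘(ℝ, E₀).prod 𝓘(ℝ, E ⧸ E₀)) S.NormalBundle) ∧
    (IsFredholmManifold 𝓘(ℝ, E) M → IsFredholmManifold 𝓘(ℝ, E).tangent
      (TangentBundle 𝓘(ℝ, E) M)) :=
  ⟨fun _ hA _ _ _ hS => EmbeddedSubmanifold.isFredholmManifold_normalBundle hA hS,
    fun ⟨_, _, hA⟩ => hA.isFredholmManifold_tangentBundle⟩
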